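/- Let $K$ agents be the vertices of a fixed graph $G$, all facing the same $N$-armed bandit. The rewards of arm $i$ have a distribution with mean $\mu_i$ that is sub-Gaussian with variance proxy $\sigma_i^2$ ($\sigma_i\ge 0$ known to the agents), i.e. $\mathbb{E}\,e^{\lambda(X_i-\mu_i)}\le e^{\lambda^2\sigma_i^2/2}$ for all real $\lambda$. There is a unique optimal arm $i^*$: $\mu_i<\mu_{i^*}$ for $i\ne i^*$. Before the start every agent $k$ receives one sample $X_i^k(0)$ of each arm $i$; rewards and initial samples are independent across times and across agents. Let $\varphi_t^k$ be the arm played by agent $k$ at time $t\ge 1$. Let $N_i^k(t)$ be the number of plays of arm $i$ up to time $t$ that agent $k$ observes, namely its own plays and those that its neighbours share with it, let $S_i^k(t)$ be the sum of the corresponding rewards, and put $$\widehat\mu_i^k(t)=\frac{S_i^k(t)+X_i^k(0)}{N_i^k(t)+1},\qquad Q_i^k(t)=\widehat\mu_i^k(t)+\sigma_i\sqrt{\frac{2(\xi+1)\log t}{N_i^k(t)+1}},\qquad \xi>1 .$$ Sampling rule: for $t\ge 1$, $\varphi_{t+1}^k=\arg\max_i Q_i^k(t)$; the first arm $\varphi_1^k$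 is an arbitrary measurable function of agent $k$'s initial samples. Communication rule: for $t\ge 0$, agent $k$ shares its choice and reward of time $t+1$ with its neighbours if and only if $\varphi_{t+1}^k\ne\arg\max_i\widehat\mu_i^k(t)$. Ties in each $\arg\max$ are broken by arbitrary measurable deterministic rules, which may depend on the agent and the time, and in the communication rule also on the arm played. Let $L(T)$ be the total number of times that agents share up to time $T$, i.e. the number of pairs $(k,t)$ with $1\le k\le K$, $1\le t\le T$ such that agent $k$ shares at time $t$. Then $L(T)$ is integrable for every $T$, and $\mathbb{E}(L(T))=O(\log T)$ as $T\to\infty$. -/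

import Mathlib

open MeasureTheory ProbabilityTheory Filter Asymptotics
open scoped NNReal

/-- The data of the algorithm run by `K` agents on an `N`-armed bandit: the communication graph, the
(known) variance proxies `σ i ^ 2` of the arms, the exploration parameter `ξ > 1`, the way the very
first arm is chosen, and the way ties in an `argmax` are broken.

* `first k v` is the arm that agent `k` plays at time `1`, when its initial samples are `v`; it is
  arbitrary, since the sampling rule only speaks about the times `t + 1` with `t ≥ 1`.
* `argmaxQ t k v` is the maximiser of `v` that agent `k` selects at time `t + 1` when `v` is the
  vector of its objective values at time `t`.
* `argmaxMean t k i v` is the maximiser of `v` to which agent `k`, having chosen arm `i` at time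
  `t + 1`, compares `i` when `v` is the vector of its estimated means at time `t`. As it may depend
  on `i`, this includes the convention under which `i` counts as exploiting whenever it is one of
  several maximisers. -/
structure Protocol (K N : ℕ) where
  graph : SimpleGraph (Fin K)
  σ : Fin N → ℝ≥0
  ξ : ℝ
  one_lt_ξ : 1 < ξ
  first : Fin K → (Fin N → ℝ) → Fin N
  argmaxQ : ℕ → Fin K → (Fin N → ℝ) → Fin N
  argmaxMean : ℕ → Fin K → Fin N → (Fin N → ℝ) → Fin N
  measurable_first : ∀ k, Measurable (first k)
  measurable_argmaxQ : ∀ t k, Measurable (argmaxQ t k)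
  measurable_argmaxMean : ∀ t k i, Measurable (argmaxMean t k i)
  le_argmaxQ : ∀ t k (v : Fin N → ℝ) j, v j ≤ v (argmaxQ t k v)
  le_argmaxMean : ∀ t k i (v : Fin N → ℝ) j, v j ≤ v (argmaxMean t k i v)

/-- What the agents have observed up to some time: `obs k i` is the number `N_i^k` of observations
of arm `i` available to agent `k` (own samples and samples received from neighbours, the initial
sample not counted), and `tot k i` is the sum `S_i^k` of the observed rewards. -/
structure Stats (K N : ℕ) where
  obs : Fin K → Fin N → ℕ
  tot : Fin K → Fin N → ℝ

namespace Protocol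

noncomputable section

variable {K N : ℕ} (A : Protocol K N)

/-- Estimated mean of arm `i` by agent `k`; `x₀ k i` is the initial sample. -/
def estMean (x₀ : Fin K → Fin N → ℝ) (s : Stats K N) (k : Fin K) (i : Fin N) : ℝ :=
  (s.tot k i + x₀ k i) / ((s.obs k i : ℝ) + 1)

/-- The uncertainty `C_i^k(t)`. -/
def bonus (t : ℕ) (s : Stats K N) (k : Fin K) (i : Fin N) : ℝ :=
  (A.σ i : ℝ) * √(2 * (A.ξ + 1) * Real.log t / ((s.obs k i : ℝ) + 1))

/-- The objective `Q_i^k(t)`. -/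
def objective (x₀ : Fin K → Fin N → ℝ) (t : ℕ) (s : Stats K N) (k : Fin K) (i : Fin N) : ℝ :=
  estMean x₀ s k i + A.bonus t s k i

/-- Sampling rule: the arm that agent `k` plays at time `t + 1`, if `s` are the statistics at
time `t`. -/
def play (x₀ : Fin K → Fin N → ℝ) (t : ℕ) (s : Stats K N) (k : Fin K) : Fin N :=
  if t = 0 then A.first k (x₀ k) else A.argmaxQ t k (A.objective x₀ t s k)

/-- Communication rule: agent `k` shares its choice and reward of time `t + 1` with its neighbours,
i.e. its action at time `t + 1` is exploring, if `s` are the statistics at time `t`. -/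
def Shares (x₀ : Fin K → Fin N → ℝ) (t : ℕ) (s : Stats K N) (k : Fin K) : Prop :=
  A.play x₀ t s k ≠ A.argmaxMean t k (A.play x₀ t s k) (estMean x₀ s k)

/-- Agent `k` observes the choice and reward of agent `j` at time `t + 1`: always if `j = k`, and
otherwise exactly if `j` is a neighbour of `k` that shares. -/
def Observes (x₀ : Fin K → Fin N → ℝ) (t : ℕ) (s : Stats K N) (k j : Fin K) : Prop :=
  j = k ∨ (A.graph.Adj k j ∧ A.Shares x₀ t s j)

open Classical in
/-- The statistics at time `t`, for the reward table `x`: `x 0 k i` is the initial sample of arm `i`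
given to agent `k`, and, for `t ≥ 1`, `x t k i` is the reward that agent `k` gets at time `t` if it
plays arm `i` at that time. -/
def stats (x : ℕ → Fin K → Fin N → ℝ) : ℕ → Stats K N
  | 0 => { obs := fun _ _ => 0, tot := fun _ _ => 0 }
  | t + 1 =>
    { obs := fun k i => (stats x t).obs k i +
        ∑ j, if A.play (x 0) t (stats x t) j = i ∧ A.Observes (x 0) t (stats x t) k j
          then 1 else 0
      tot := fun k i => (stats x t).tot k i +
        ∑ j, if A.play (x 0) t (stats x t) j = i ∧ A.Observes (x 0) t (stats x t) k j
          then x (t + 1) j i else 0 }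

open Classical in
/-- The group communication cost `L(T)`: the number of broadcasts by all agents at the times
`1, …, T` (the summand of index `t` is the indicator of a broadcast at time `t + 1`). -/
def commCost (x : ℕ → Fin K → Fin N → ℝ) (T : ℕ) : ℕ :=
  ∑ k, ∑ t ∈ Finset.range T, if A.Shares (x 0) t (A.stats x t) k then 1 else 0

end

end Protocol

/-! Suppose agent `k` shares at time `t + 1`. If it plays a suboptimal arm while all its confidence
intervals hold, the usual UCB argument shows that this arm has `O(log T)` observations; every play
adds an observation, so this happens `O(log T)` times. If it plays the optimal arm, some other arm
`q` has at least as large an estimated mean but no larger index, hence no larger bonus. So `q` has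
been observed at least a constant times as often as the optimal arm, and one of the two estimates is
off by half the smallest gap. With `m + 1` samples such an error has probability exponentially small
in `m`, and only `O(m)` plays of the optimal arm are compatible with it, so the expected number of
these rounds is bounded. Failures of confidence intervals have probability `O(t ^ (-ξ))`, which is
summable. This trichotomy is `cases_of_shares`; `commCost_le_sum` counts the rounds.

Both probability bounds rest on `measure_deviation_le`. The samples an agent sees are selected
adaptively, but whether a reward is seen is decided before it is drawn, so the exponential of the
centred sum is a supermartingale. Freezing it at a given sample count makes the bound uniform over
the times at which that count is held. -/

namespace Protocol

/-! ### Observation counts and the frozen exponent along a fixed reward table -/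

section Deterministic

variable {K N : ℕ} (A : Protocol K N) (x : ℕ → Fin K → Fin N → ℝ)

/-- At time `t + 1`, agent `k` observes a reward of arm `i` that is sampled by agent `j`. -/
def Gets (k : Fin K) (i : Fin N) (t : ℕ) (j : Fin K) : Prop :=
  A.play (x 0) t (A.stats x t) j = i ∧ A.Observes (x 0) t (A.stats x t) k j

open Classical in
lemma obs_succ (t : ℕ) (k : Fin K) (i : Fin N) :
    (A.stats x (t + 1)).obs k i =
      (A.stats x t).obs k i + ∑ j, if A.Gets x k i t j then 1 else 0 := 
  congrArg (_ + ·) (Finset.sum_congr rfl fun _ _ => if_congr Iff.rfl rfl rfl)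

open Classical in
lemma tot_succ (t : ℕ) (k : Fin K) (i : Fin N) :
    (A.stats x (t + 1)).tot k i =
      (A.stats x t).tot k i + ∑ j, if A.Gets x k i t j then x (t + 1) j i else 0 := 
  congrArg (_ + ·) (Finset.sum_congr rfl fun _ _ => if_congr Iff.rfl rfl rfl)

lemma monotone_obs (k : Fin K) (i : Fin N) : Monotone fun t => (A.stats x t).obs k i :=
  monotone_nat_of_le_succ fun t => by rw [obs_succ]; exact Nat.le_add_right _ _

lemma obs_lt_obs_succ_of_gets {k : Fin K} {i : Fin N} {t : ℕ} {j : Fin K}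
    (h : A.Gets x k i t j) : (A.stats x t).obs k i < (A.stats x (t + 1)).obs k i := by
  classical
  rw [obs_succ]
  have := Finset.single_le_sum (f := fun j => if A.Gets x k i t j then 1 else 0)
    (fun _ _ => Nat.zero_le _) (Finset.mem_univ j)
  simp only [h, if_true] at this
  omega

lemma obs_lt_obs_of_play {k : Fin K} {i : Fin N} {s t : ℕ} (hst : s < t)
    (h : A.play (x 0) s (A.stats x s) k = i) :
    (A.stats x s).obs k i < (A.stats x t).obs k i :=
  (A.obs_lt_obs_succ_of_gets x ⟨h, Or.inl rfl⟩).trans_le (A.monotone_obs x k i hst)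

lemma obs_le (t : ℕ) (k : Fin K) (i : Fin N) : (A.stats x t).obs k i ≤ K * t := by
  classical
  induction t with
  | zero => simp [stats]
  | succ t ih =>
    rw [obs_succ, mul_add, mul_one]
    refine add_le_add ih ?_
    calc _ ≤ ∑ _j : Fin K, 1 := Finset.sum_le_sum fun j _ => by split_ifs <;> simp
      _ = K := by simp

/-- An agent always observes its own play, so the count grows strictly with each one. Counting plays
thus reduces to counting values of `obs`. -/
lemma injOn_obs_play (k : Fin K) (i : Fin N) :
    Set.InjOn (fun t => (A.stats x t).obs k i)
      {t | A.play (x 0) t (A.stats x t) k = i} := by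
  intro s hs t ht hst
  rcases lt_trichotomy s t with h | h | h
  · exact absurd hst (A.obs_lt_obs_of_play x h hs).ne
  · exact h
  · exact absurd hst (A.obs_lt_obs_of_play x h ht).ne'

/-- The deviation of the sum of the samples of arm `i` known to agent `k` from its compensator. -/
noncomputable def deviation (μ : ℝ) (k : Fin K) (i : Fin N) (t : ℕ) : ℝ :=
  (A.stats x t).tot k i + x 0 k i - ((A.stats x t).obs k i + 1) * μ

lemma estMean_sub (μ : ℝ) (k : Fin K) (i : Fin N) (t : ℕ) :
    estMean (x 0) (A.stats x t) k i - μ =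
      A.deviation x μ k i t / ((A.stats x t).obs k i + 1) := by
  have : ((A.stats x t).obs k i + 1 : ℝ) ≠ 0 := by positivity
  simp only [estMean, deviation]
  field_simp

lemma deviation_eq_zero {μ : ℝ} {i : Fin N} (h : ∀ t k, x t k i = μ) (k : Fin K) (t : ℕ) :
    A.deviation x μ k i t = 0 := by
  classical
  have : (A.stats x t).tot k i = (A.stats x t).obs k i * μ := by
    induction t with
    | zero => simp [stats]
    | succ t ih =>
      rw [obs_succ, tot_succ, ih]
      simp [h, Finset.sum_ite, add_mul]
  rw [deviation, this, h]; ring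

open Classical in
/-- The exponent of the supermartingale of parameter `l` for the samples of arm `i` known to
agent `k`, frozen once `n` of them have been observed. -/
noncomputable def frozenExponent (k : Fin K) (i : Fin N) (n : ℕ) (l μ v : ℝ) (t : ℕ) : ℝ :=
  l * (x 0 k i - μ) - v + ∑ s ∈ Finset.range t, ∑ j,
    if A.Gets x k i s j ∧ (A.stats x s).obs k i < n then l * (x (s + 1) j i - μ) - v else 0

lemma frozenExponent_of_obs_le {k : Fin K} {i : Fin N} {n : ℕ} (l μ v : ℝ) {t : ℕ}
    (h : (A.stats x t).obs k i ≤ n) :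
    A.frozenExponent x k i n l μ v t =
      l * A.deviation x μ k i t - ((A.stats x t).obs k i + 1) * v := by
  classical
  induction t with
  | zero => simp [frozenExponent, deviation, stats]
  | succ t ih =>
    have hle := (A.monotone_obs x k i (Nat.le_succ t)).trans h
    -- An observation raises the count strictly, so if the count is still at most `n` afterwards,
    -- the freeze was not active.
    have hif : ∀ j, (A.Gets x k i t j ∧ (A.stats x t).obs k i < n) ↔ A.Gets x k i t j :=
      fun j => and_iff_left_of_imp fun hj => (A.obs_lt_obs_succ_of_gets x hj).trans_le h
    have ih := ih hle
    rw [frozenExponent] at ih ⊢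
    rw [Finset.sum_range_succ, ← add_assoc, ih, deviation, deviation, obs_succ, tot_succ]
    simp only [hif, ← Finset.sum_filter, Finset.sum_sub_distrib, ← Finset.mul_sum,
      Finset.sum_const, nsmul_eq_mul, smul_eq_mul, mul_one]
    push_cast
    ring

/-- Once the count is `n` nothing more is added, so the value at the final time `T` remembers the
deviation at time `t`. This replaces optional stopping. -/
lemma frozenExponent_of_obs_eq {k : Fin K} {i : Fin N} {n : ℕ} (l μ v : ℝ) {t T : ℕ}
    (htT : t ≤ T) (h : (A.stats x t).obs k i = n) :
    A.frozenExponent x k i n l μ v T = l * A.deviation x μ k i t - (n + 1) * v := by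
  classical
  induction T, htT using Nat.le_induction with
  | base => rw [A.frozenExponent_of_obs_le x l μ v h.le, h]
  | succ T hT ih =>
    have hge : ¬ (A.stats x T).obs k i < n := by
      rw [← h, not_lt]; exact A.monotone_obs x k i hT
    rw [← ih, frozenExponent, frozenExponent, Finset.sum_range_succ]
    simp [hge]

end Deterministic

/-! ### Measurability of the statistics and decisions -/

section Measurability

variable {K N : ℕ} (A : Protocol K N) {Ω : Type*} [MeasurableSpace Ω]

lemma measurable_estMean {x₀ : Fin K → Fin N → Ω → ℝ} {s : Ω → Stats K N} {k : Fin K}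
    (hx : ∀ i, Measurable (x₀ k i)) (ho : ∀ i, Measurable fun ω => (s ω).obs k i)
    (ht : ∀ i, Measurable fun ω => (s ω).tot k i) :
    Measurable fun ω => estMean (fun k i => x₀ k i ω) (s ω) k := by
  refine measurable_pi_lambda _ fun i => ?_
  have h1 := hx i
  have h2 := ht i
  have h3 : Measurable fun ω => ((s ω).obs k i : ℝ) := measurable_from_top.comp (ho i)
  unfold estMean
  fun_prop

lemma measurable_play {x₀ : Fin K → Fin N → Ω → ℝ} {s : Ω → Stats K N} {k : Fin K} (t : ℕ)
    (hx : ∀ i, Measurable (x₀ k i)) (ho : ∀ i, Measurable fun ω => (s ω).obs k i)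
    (ht : ∀ i, Measurable fun ω => (s ω).tot k i) :
    Measurable fun ω => A.play (fun k i => x₀ k i ω) t (s ω) k := by
  by_cases h0 : t = 0
  · simp only [play, h0, if_true]
    exact (A.measurable_first k).comp (measurable_pi_lambda _ hx)
  · simp only [play, h0, if_false]
    refine (A.measurable_argmaxQ t k).comp (measurable_pi_lambda _ fun i => ?_)
    have h1 := (measurable_pi_apply i).comp (measurable_estMean hx ho ht)
    have h3 : Measurable fun ω => ((s ω).obs k i : ℝ) := measurable_from_top.comp (ho i)
    simp only [objective, bonus]
    refine h1.add ?_
    fun_prop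

lemma measurableSet_shares {x₀ : Fin K → Fin N → Ω → ℝ} {s : Ω → Stats K N} {k : Fin K} (t : ℕ)
    (hx : ∀ i, Measurable (x₀ k i)) (ho : ∀ i, Measurable fun ω => (s ω).obs k i)
    (ht : ∀ i, Measurable fun ω => (s ω).tot k i) :
    MeasurableSet {ω | A.Shares (fun k i => x₀ k i ω) t (s ω) k} := by
  have hp := A.measurable_play t hx ho ht
  have he := measurable_estMean hx ho ht
  have ha : Measurable fun p : Fin N × (Fin N → ℝ) => A.argmaxMean t k p.1 p.2 :=
    measurable_from_prod_countable_right fun i => A.measurable_argmaxMean t k i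
  exact (measurableSet_eq_fun hp (ha.comp (hp.prodMk he))).compl

lemma measurableSet_gets_aux {x₀ : Fin K → Fin N → Ω → ℝ} {s : Ω → Stats K N} (t : ℕ)
    (hx : ∀ k i, Measurable (x₀ k i)) (ho : ∀ k i, Measurable fun ω => (s ω).obs k i)
    (ht : ∀ k i, Measurable fun ω => (s ω).tot k i) (k j : Fin K) (i : Fin N) :
    MeasurableSet {ω | A.play (fun k i => x₀ k i ω) t (s ω) j = i ∧
      A.Observes (fun k i => x₀ k i ω) t (s ω) k j} := by
  have h1 := A.measurable_play t (hx j) (ho j) (ht j)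
  have h2 := A.measurableSet_shares t (hx j) (ho j) (ht j)
  exact (h1 (measurableSet_singleton i)).inter
    ((MeasurableSet.const _).union ((MeasurableSet.const _).inter h2))

/-- Only samples up to time `t` are assumed measurable, so that the lemma also applies with the
σ-algebra `past X t`. -/
lemma measurable_stats (X : ℕ → Fin K → Fin N → Ω → ℝ) (t : ℕ)
    (hX : ∀ s ≤ t, ∀ k i, Measurable (X s k i)) :
    (∀ k i, Measurable fun ω => (A.stats (fun t k i => X t k i ω) t).obs k i) ∧
    (∀ k i, Measurable fun ω => (A.stats (fun t k i => X t k i ω) t).tot k i) := by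
  classical
  induction t with
  | zero => simp [stats]
  | succ t ih =>
    obtain ⟨ho, ht⟩ := ih fun s hs => hX s (hs.trans (Nat.le_succ t))
    have hg := A.measurableSet_gets_aux t (hX 0 (Nat.zero_le _)) ho ht
    constructor
    · intro k i
      refine (ho k i).add (Finset.measurable_fun_sum _ fun j _ => ?_)
      exact Measurable.ite (hg k j i) measurable_const measurable_const
    · intro k i
      refine (ht k i).add (Finset.measurable_fun_sum _ fun j _ => ?_)
      exact Measurable.ite (hg k j i) (hX _ le_rfl j i) measurable_const

lemma measurableSet_gets (X : ℕ → Fin K → Fin N → Ω → ℝ) (t : ℕ)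
    (hX : ∀ s ≤ t, ∀ k i, Measurable (X s k i)) (k j : Fin K) (i : Fin N) :
    MeasurableSet {ω | A.Gets (fun t k i => X t k i ω) k i t j} :=
  A.measurableSet_gets_aux t (hX 0 (Nat.zero_le _)) (A.measurable_stats X t hX).1
    (A.measurable_stats X t hX).2 k j i

lemma measurable_commCost (X : ℕ → Fin K → Fin N → Ω → ℝ)
    (hX : ∀ t k i, Measurable (X t k i)) (T : ℕ) :
    Measurable fun ω => A.commCost (fun t k i => X t k i ω) T := by
  classical
  refine Finset.measurable_fun_sum _ fun k _ => Finset.measurable_fun_sum _ fun t _ => ?_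
  obtain ⟨ho, ht⟩ := A.measurable_stats X t fun s _ => hX s
  exact Measurable.ite (A.measurableSet_shares t (hX 0 k) (ho k) (ht k))
    measurable_const measurable_const

lemma commCost_le (x : ℕ → Fin K → Fin N → ℝ) (T : ℕ) : A.commCost x T ≤ K * T := by
  classical
  calc A.commCost x T ≤ ∑ _k : Fin K, ∑ _t ∈ Finset.range T, 1 :=
        Finset.sum_le_sum fun k _ => Finset.sum_le_sum fun t _ => by split_ifs <;> simp
    _ = K * T := by simp

end Measurability

end Protocol

/-! ### Predictable selection of independent factors -/

section Past

variable {Ω ι E : Type*} [MeasurableSpace E]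

/-- The σ-algebra generated by the variables `f p` with `p ∈ S`. -/
abbrev pastOf (f : ι → Ω → E) (S : Set ι) : MeasurableSpace Ω :=
  ⨆ p ∈ S, MeasurableSpace.comap (f p) inferInstance

variable {f : ι → Ω → E}

lemma pastOf_mono {S S' : Set ι} (h : S ⊆ S') : pastOf f S ≤ pastOf f S' :=
  biSup_mono h

lemma measurable_pastOf {S : Set ι} {p : ι} (hp : p ∈ S) : Measurable[pastOf f S] (f p) :=
  measurable_iff_comap_le.2 (le_biSup (fun p => MeasurableSpace.comap (f p) inferInstance) hp)

variable [mΩ : MeasurableSpace Ω] {P : Measure Ω}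

lemma pastOf_le (hf : ∀ p, Measurable (f p)) (S : Set ι) : pastOf f S ≤ mΩ :=
  iSup₂_le fun p _ => (hf p).comap_le

open Classical in
/-- A factor of mean at most `1` that is independent of the past, used or not according to a
decision taken on the basis of the past, does not increase the integral. -/
lemma lintegral_mul_ite_le (hf : ∀ p, Measurable (f p)) (hind : iIndepFun f P) {S : Set ι} {q : ι}
    (hq : q ∉ S) {U : Ω → ENNReal} (hU : Measurable[pastOf f S] U) {b : Ω → Prop}
    (hb : MeasurableSet[pastOf f S] {ω | b ω}) {Z : E → ENNReal} (hZ : Measurable Z)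
    (hZ1 : ∫⁻ ω, Z (f q ω) ∂P ≤ 1) :
    ∫⁻ ω, U ω * (if b ω then Z (f q ω) else 1) ∂P ≤ ∫⁻ ω, U ω ∂P := by
  have hle := pastOf_le hf S
  have hindep : Indep (pastOf f S) (MeasurableSpace.comap (f q) inferInstance) P := by
    have := indep_iSup_of_disjoint (fun p => (hf p).comap_le) hind
      (Set.disjoint_singleton_right.2 hq)
    simpa [pastOf] using this
  have hUb : Measurable[pastOf f S] ({ω | b ω}.indicator U) := hU.indicator hb
  have hmul := lintegral_mul_eq_lintegral_mul_lintegral_of_independent_measurableSpace hle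
    (hf q).comap_le hindep hUb (hZ.comp (comap_measurable (f q)))
  calc ∫⁻ ω, U ω * (if b ω then Z (f q ω) else 1) ∂P
      = ∫⁻ ω, ({ω | b ω}.indicator U ω * (Z ∘ f q) ω + {ω | b ω}ᶜ.indicator U ω) ∂P := by
        refine lintegral_congr fun ω => ?_
        by_cases h : b ω <;> simp [h]
    _ = (∫⁻ ω, {ω | b ω}.indicator U ω ∂P) * (∫⁻ ω, (Z ∘ f q) ω ∂P)
          + ∫⁻ ω, {ω | b ω}ᶜ.indicator U ω ∂P := by
        rw [lintegral_add_right _ ((hU.indicator hb.compl).mono hle le_rfl), hmul]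
    _ ≤ (∫⁻ ω, {ω | b ω}.indicator U ω ∂P) * 1 + ∫⁻ ω, {ω | b ω}ᶜ.indicator U ω ∂P := by
        gcongr; exact hZ1
    _ = ∫⁻ ω, U ω ∂P := by
        rw [mul_one, ← lintegral_add_left (hUb.mono hle le_rfl)]
        refine lintegral_congr fun ω => ?_
        by_cases h : b ω <;> simp [h]

open Classical in
-- Several factors may enter in the same round. They are removed one at a time, the remaining ones
-- being counted as part of an enlarged past.
lemma lintegral_mul_prod_ite_le (hf : ∀ p, Measurable (f p)) (hind : iIndepFun f P) {S : Set ι}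
    {α : Type*} {q : α → ι} (hq : Function.Injective q) (hqS : ∀ j, q j ∉ S) {U : Ω → ENNReal}
    (hU : Measurable[pastOf f S] U) {b : α → Ω → Prop}
    (hb : ∀ j, MeasurableSet[pastOf f S] {ω | b j ω}) {Z : E → ENNReal} (hZ : Measurable Z)
    (hZ1 : ∀ j, ∫⁻ ω, Z (f (q j) ω) ∂P ≤ 1) (s : Finset α) :
    ∫⁻ ω, U ω * ∏ j ∈ s, (if b j ω then Z (f (q j) ω) else 1) ∂P ≤ ∫⁻ ω, U ω ∂P := by
  induction s using Finset.induction_on with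
  | empty => simp
  | insert a s ha ih =>
    refine le_trans (le_of_eq ?_) ((lintegral_mul_ite_le hf hind (S := S ∪ q '' s) (q := q a)
      (U := fun ω => U ω * ∏ j ∈ s, (if b j ω then Z (f (q j) ω) else 1))
      ?_ ?_ (b := b a) ?_ hZ (hZ1 a)).trans ih)
    · refine lintegral_congr fun ω => ?_
      rw [Finset.prod_insert ha, mul_assoc, mul_comm (∏ j ∈ s, _)]
    · rintro (h | ⟨j, hj, h⟩)
      · exact hqS a h
      · exact ha (hq h ▸ hj)
    · have hm := pastOf_mono (f := f) (Set.subset_union_left (s := S) (t := q '' s))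
      refine (hU.mono hm le_rfl).mul (Finset.measurable_fun_prod _ fun j hj => ?_)
      refine Measurable.ite (hm _ (hb j)) (hZ.comp (measurable_pastOf ?_)) measurable_const
      exact Or.inr ⟨j, hj, rfl⟩
    · exact pastOf_mono Set.subset_union_left _ (hb a)

end Past

/-! ### Concentration for adaptively observed samples -/

namespace Protocol

variable {K N : ℕ} (A : Protocol K N) {Ω : Type*} {X : ℕ → Fin K → Fin N → Ω → ℝ}

/-- The σ-algebra generated by all samples up to time `t`. -/
abbrev past (X : ℕ → Fin K → Fin N → Ω → ℝ) (t : ℕ) : MeasurableSpace Ω :=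
  pastOf (fun (p : ℕ × Fin K) (ω : Ω) (i : Fin N) => X p.1 p.2 i ω) {p | p.1 ≤ t}

lemma measurable_past {s t : ℕ} (h : s ≤ t) (k : Fin K) (i : Fin N) :
    Measurable[past X t] (X s k i) :=
  (measurable_pi_apply i).comp (measurable_pastOf
    (f := fun (p : ℕ × Fin K) (ω : Ω) (i : Fin N) => X p.1 p.2 i ω) (p := (s, k)) h)

variable [mΩ : MeasurableSpace Ω] {P : Measure Ω} {ν : Fin N → Measure ℝ}

lemma lintegral_exp_le_one {i : Fin N} [IsProbabilityMeasure (ν i)] {μ : ℝ} {σ : ℝ≥0}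
    (hsub : HasSubgaussianMGF (fun y => y - μ) (σ ^ 2) (ν i)) {Y : Ω → ℝ} (hY : Measurable Y)
    (hlaw : P.map Y = ν i) (l : ℝ) :
    ∫⁻ ω, ENNReal.ofReal (Real.exp (l * (Y ω - μ) - l ^ 2 * σ ^ 2 / 2)) ∂P ≤ 1 := by
  have h1 : ∫⁻ ω, ENNReal.ofReal (Real.exp (l * (Y ω - μ) - l ^ 2 * σ ^ 2 / 2)) ∂P =
      ∫⁻ y, ENNReal.ofReal (Real.exp (l * (y - μ) - l ^ 2 * σ ^ 2 / 2)) ∂(ν i) := by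
    rw [← hlaw, lintegral_map (by fun_prop) hY]
  have hint := hsub.integrable_exp_mul l
  have hle := hsub.mgf_le l
  rw [h1, ← ofReal_integral_eq_lintegral_ofReal]
  · rw [ENNReal.ofReal_le_one]
    simp only [Real.exp_sub, integral_div]
    rw [div_le_one (Real.exp_pos _)]
    refine hle.trans_eq ?_
    push_cast
    ring_nf
  · simp only [Real.exp_sub]
    exact hint.div_const _
  · exact ae_of_all _ fun y => (Real.exp_pos _).le

/-- Each new term is a fresh reward with compensated exponential moment at most `1`, admitted by a
decision about the past; hence the integral does not increase with `t`. -/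
lemma lintegral_exp_frozenExponent_le_one (hmeas : ∀ t k i, Measurable (X t k i))
    (hlaw : ∀ t k i, P.map (X t k i) = ν i)
    (hindep : iIndepFun (fun (p : ℕ × Fin K) (ω : Ω) (i : Fin N) => X p.1 p.2 i ω) P)
    {i : Fin N} [IsProbabilityMeasure (ν i)] {μ : ℝ} {σ : ℝ≥0}
    (hsub : HasSubgaussianMGF (fun y => y - μ) (σ ^ 2) (ν i)) (k : Fin K) (n : ℕ) (l : ℝ) (t : ℕ) :
    ∫⁻ ω, ENNReal.ofReal (Real.exp (A.frozenExponent (fun t k i => X t k i ω) k i n l μ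
      (l ^ 2 * σ ^ 2 / 2) t)) ∂P ≤ 1 := by
  classical
  set v := l ^ 2 * (σ : ℝ) ^ 2 / 2 with hv
  have hgets : ∀ t j, MeasurableSet[past X t] {ω | A.Gets (fun t k i => X t k i ω) k i t j ∧
      (A.stats (fun t k i => X t k i ω) t).obs k i < n} := fun t j => by
    have hX : ∀ s ≤ t, ∀ k i, Measurable[past X t] (X s k i) := fun s hs => measurable_past hs
    exact (@measurableSet_gets _ _ A Ω (past X t) X t hX k j i).inter
      ((@measurable_stats _ _ A Ω (past X t) X t hX).1 k i measurableSet_Iio)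
  have hMmeas : ∀ t, Measurable[past X t] fun ω => ENNReal.ofReal (Real.exp (A.frozenExponent
      (fun t k i => X t k i ω) k i n l μ v t)) := fun t => by
    refine ENNReal.measurable_ofReal.comp (Real.measurable_exp.comp ?_)
    refine ((((measurable_past (Nat.zero_le t) k i).sub_const μ).const_mul l).sub_const v).add
      (Finset.measurable_fun_sum _ fun s hs => Finset.measurable_fun_sum _ fun j _ => ?_)
    have hst := Finset.mem_range.1 hs
    refine Measurable.ite (pastOf_mono (fun p hp => ?_) _ (hgets s j))
      ((((measurable_past hst j i).sub_const μ).const_mul l).sub_const v) measurable_const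
    exact le_trans (show p.1 ≤ s from hp) hst.le
  induction t with
  | zero => simpa [frozenExponent] using lintegral_exp_le_one hsub (hmeas 0 k i) (hlaw 0 k i) l
  | succ t ih =>
    refine le_trans ?_ ih
    refine le_trans (le_of_eq ?_) (lintegral_mul_prod_ite_le
      (fun p => measurable_pi_lambda _ fun i => hmeas p.1 p.2 i) hindep
      (q := fun j : Fin K => (t + 1, j)) (fun a b h => (Prod.mk.inj h).2)
      (S := {p | p.1 ≤ t}) (fun j => by simp) (hMmeas t) (hgets t)
      (Z := fun y => ENNReal.ofReal (Real.exp (l * (y i - μ) - v))) (by fun_prop)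
      (fun j => lintegral_exp_le_one hsub (hmeas _ _ _) (hlaw _ _ _) l) Finset.univ)
    refine lintegral_congr fun ω => ?_
    rw [frozenExponent, Finset.sum_range_succ, ← add_assoc, Real.exp_add,
      ENNReal.ofReal_mul (Real.exp_pos _).le, Real.exp_sum,
      ENNReal.ofReal_prod_of_nonneg fun _ _ => (Real.exp_pos _).le]
    congr 1
    refine Finset.prod_congr rfl fun j _ => ?_
    split_ifs <;> simp

/-- One-sided version of `measure_deviation_le`, for either sign. -/
lemma measure_deviation_le_aux (hmeas : ∀ t k i, Measurable (X t k i))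
    (hlaw : ∀ t k i, P.map (X t k i) = ν i)
    (hindep : iIndepFun (fun (p : ℕ × Fin K) (ω : Ω) (i : Fin N) => X p.1 p.2 i ω) P)
    {i : Fin N} [IsProbabilityMeasure (ν i)] {μ : ℝ} {σ : ℝ≥0} (hσ : 0 < σ)
    (hsub : HasSubgaussianMGF (fun y => y - μ) (σ ^ 2) (ν i)) (k : Fin K) (n T : ℕ) (y : ℝ)
    {e : ℝ} (he : e ^ 2 = 1) (hy : 0 ≤ y) :
    P.real {ω | ∃ t ≤ T, (A.stats (fun t k i => X t k i ω) t).obs k i = n ∧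
      y ≤ e * A.deviation (fun t k i => X t k i ω) μ k i t} ≤
      Real.exp (-(y ^ 2 / (2 * (n + 1) * σ ^ 2))) := by
  have hσ' : (0 : ℝ) < σ := hσ
  -- The maximiser of `l * y - (n + 1) * l ^ 2 * σ ^ 2 / 2`, whose maximum is `a`.
  set l : ℝ := y / ((n + 1) * σ ^ 2) with hl
  have hl0 : 0 ≤ l := by positivity
  set a : ℝ := y ^ 2 / (2 * (n + 1) * σ ^ 2) with ha
  have key : P {ω | ∃ t ≤ T, (A.stats (fun t k i => X t k i ω) t).obs k i = n ∧
      y ≤ e * A.deviation (fun t k i => X t k i ω) μ k i t} ≤ ENNReal.ofReal (Real.exp (-a)) := by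
    have hsup := A.lintegral_exp_frozenExponent_le_one hmeas hlaw hindep hsub k n (e * l) T
    -- Markov's inequality at the single time `T` covers every `t ≤ T`, thanks to the freezing.
    refine le_trans (measure_mono (t := {ω | ENNReal.ofReal (Real.exp a) ≤
      ENNReal.ofReal (Real.exp (A.frozenExponent (fun t k i => X t k i ω) k i n (e * l) μ
      ((e * l) ^ 2 * σ ^ 2 / 2) T))}) ?_) (le_trans (meas_ge_le_lintegral_div ?_ ?_ ?_)
        (le_trans (ENNReal.div_le_div_right hsup _) ?_))
    · rintro ω ⟨t, htT, hn, hyt⟩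
      refine ENNReal.ofReal_le_ofReal (Real.exp_le_exp.2 ?_)
      rw [A.frozenExponent_of_obs_eq _ _ _ _ htT hn]
      have h1 := mul_le_mul_of_nonneg_left hyt hl0
      have h2 : a = l * y - (n + 1) * (l ^ 2 * σ ^ 2 / 2) := by
        rw [ha, hl]; field_simp; ring
      rw [mul_pow, he, h2]
      linarith
    · refine (ENNReal.measurable_ofReal.comp (Real.measurable_exp.comp ?_)).aemeasurable
      classical
      refine ((((hmeas 0 k i).sub_const μ).const_mul _).sub_const _).add
        (Finset.measurable_fun_sum _ fun s _ => Finset.measurable_fun_sum _ fun j _ => ?_)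
      refine Measurable.ite ((A.measurableSet_gets X s (fun s _ => hmeas s) k j i).inter
        ((A.measurable_stats X s fun s _ => hmeas s).1 k i measurableSet_Iio))
        ((((hmeas _ j i).sub_const μ).const_mul _).sub_const _) measurable_const
    · simp [Real.exp_pos]
    · simp
    · rw [Real.exp_neg, ENNReal.ofReal_inv_of_pos (Real.exp_pos _), one_div]
  exact ENNReal.toReal_le_of_le_ofReal (Real.exp_pos _).le key

variable [IsProbabilityMeasure P]

/-- Maximal inequality for the deviation of the sum of the samples of an arm, over the times at
which their number takes a given value. -/
lemma measure_deviation_le (hmeas : ∀ t k i, Measurable (X t k i))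
    (hlaw : ∀ t k i, P.map (X t k i) = ν i)
    (hindep : iIndepFun (fun (p : ℕ × Fin K) (ω : Ω) (i : Fin N) => X p.1 p.2 i ω) P)
    {i : Fin N} [IsProbabilityMeasure (ν i)] {μ : ℝ} {σ : ℝ≥0} (hσ : 0 < σ)
    (hsub : HasSubgaussianMGF (fun y => y - μ) (σ ^ 2) (ν i)) (k : Fin K) (n T : ℕ) {y : ℝ}
    (hy : 0 ≤ y) :
    P.real {ω | ∃ t ≤ T, (A.stats (fun t k i => X t k i ω) t).obs k i = n ∧
      y ≤ |A.deviation (fun t k i => X t k i ω) μ k i t|} ≤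
      2 * Real.exp (-(y ^ 2 / (2 * (n + 1) * σ ^ 2))) := by
  have h1 := A.measure_deviation_le_aux hmeas hlaw hindep hσ hsub k n T y (e := 1) (by norm_num) hy
  have h2 := A.measure_deviation_le_aux hmeas hlaw hindep hσ hsub k n T y (e := -1) (by norm_num) hy
  rw [two_mul]
  refine le_trans ?_ (add_le_add h1 h2)
  refine le_trans (measureReal_mono ?_) (measureReal_union_le _ _)
  rintro ω ⟨t, ht, hn, hyt⟩
  rcases le_abs.1 hyt with h | h
  · exact Or.inl ⟨t, ht, hn, by linarith⟩
  · exact Or.inr ⟨t, ht, hn, by linarith⟩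

/-! ### Why an agent shares, and how often: pathwise counting -/

section Pathwise

variable {K N : ℕ} (A : Protocol K N) (x : ℕ → Fin K → Fin N → ℝ)

lemma bonus_nonneg (t : ℕ) (s : Stats K N) (k : Fin K) (i : Fin N) : 0 ≤ A.bonus t s k i :=
  mul_nonneg (A.σ i).2 (Real.sqrt_nonneg _)

lemma bonus_sq_mul (t : ℕ) (s : Stats K N) (k : Fin K) (i : Fin N) :
    A.bonus t s k i ^ 2 * ((s.obs k i : ℝ) + 1) =
      (A.σ i : ℝ) ^ 2 * (2 * (A.ξ + 1) * Real.log t) := by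
  have h1 : (0 : ℝ) < (s.obs k i : ℝ) + 1 := by positivity
  have h2 : 0 ≤ Real.log t := Real.log_natCast_nonneg t
  have h3 := A.one_lt_ξ
  rw [bonus, mul_pow, Real.sq_sqrt (by positivity)]
  field_simp

open Classical in
/-- An agent plays a given arm at most `B` times while it knows at most `B` samples of it. -/
lemma card_play_obs_le (k : Fin K) (i : Fin N) (T : ℕ) {B : ℝ} (hB : 0 ≤ B) :
    (((Finset.range T).filter fun t => A.play (x 0) t (A.stats x t) k = i ∧
      ((A.stats x t).obs k i : ℝ) + 1 ≤ B).card : ℝ) ≤ B := by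
  refine le_trans (Nat.cast_le.2 ?_) (Nat.floor_le hB)
  rw [← Finset.card_range ⌊B⌋₊]
  refine Finset.card_le_card_of_injOn (fun t => (A.stats x t).obs k i) (fun t ht => ?_)
    ((A.injOn_obs_play x k i).mono fun t ht => ?_)
  · have := (Finset.mem_filter.1 ht).2.2
    exact Finset.mem_coe.2 (Finset.mem_range.2 (Nat.le_floor (by push_cast; exact this)))
  · exact (Finset.mem_filter.1 ht).2.1

/-- The event that the mean of `m + 1` samples of arm `i` known to agent `k` at some time up to `T`
is off by at least `ε`. -/
def MeanOff (μ : ℝ) (k : Fin K) (i : Fin N) (ε : ℝ) (m T : ℕ) : Prop :=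
  ∃ t ≤ T, (A.stats x t).obs k i = m ∧ ε ≤ |estMean (x 0) (A.stats x t) k i - μ|

open Classical in
-- The rounds are grouped by the count `m` of arm `i`. In a group arm `i₀` has at most `(m + 1) / c`
-- samples, so it is played at most that often, and the group is empty unless the mean of `m + 1`
-- samples is off.
lemma card_play_meanOff_le (μ : ℝ) (k : Fin K) (i i₀ : Fin N) (T : ℕ) {c ε : ℝ} (hc : 0 < c) :
    (((Finset.range T).filter fun t => A.play (x 0) t (A.stats x t) k = i₀ ∧
      c * (((A.stats x t).obs k i₀ : ℝ) + 1) ≤ ((A.stats x t).obs k i : ℝ) + 1 ∧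
      ε ≤ |estMean (x 0) (A.stats x t) k i - μ|).card : ℝ) ≤
    ∑ m ∈ Finset.range (K * T + 1), if A.MeanOff x μ k i ε m T then ((m : ℝ) + 1) / c else 0 := by
  set S := (Finset.range T).filter fun t => A.play (x 0) t (A.stats x t) k = i₀ ∧
      c * (((A.stats x t).obs k i₀ : ℝ) + 1) ≤ ((A.stats x t).obs k i : ℝ) + 1 ∧
      ε ≤ |estMean (x 0) (A.stats x t) k i - μ| with hS
  have hmaps : ∀ t ∈ S, (A.stats x t).obs k i ∈ Finset.range (K * T + 1) := fun t ht => by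
    have := Finset.mem_range.1 (Finset.mem_filter.1 ht).1
    exact Finset.mem_range.2 (Nat.lt_succ_of_le
      ((A.obs_le x t k i).trans (Nat.mul_le_mul_left K this.le)))
  rw [Finset.card_eq_sum_card_fiberwise hmaps, Nat.cast_sum]
  refine Finset.sum_le_sum fun m _ => ?_
  split_ifs with h
  · refine le_trans (Nat.cast_le.2 (Finset.card_le_card fun t ht => ?_))
      (A.card_play_obs_le x k i₀ T (B := ((m : ℝ) + 1) / c) (by positivity))
    obtain ⟨htS, hm⟩ := Finset.mem_filter.1 ht
    obtain ⟨hT, hp, hcm, -⟩ := Finset.mem_filter.1 htS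
    refine Finset.mem_filter.2 ⟨hT, hp, ?_⟩
    rw [le_div_iff₀ hc, mul_comm, ← hm]
    exact hcm
  · rw [Nat.cast_nonpos, Finset.card_eq_zero, Finset.filter_eq_empty_iff]
    intro t ht hm
    obtain ⟨hT, -, -, he⟩ := Finset.mem_filter.1 ht
    exact h ⟨t, (Finset.mem_range.1 hT).le, hm, he⟩

/-- A broadcast is due to an estimated mean outside its confidence interval, to a suboptimal arm
that is sampled too rarely, or to an estimated mean that is wrong although it is based on many
samples. -/
lemma cases_of_shares {μ : Fin N → ℝ} {istar : Fin N} (hopt : ∀ i, i ≠ istar → μ i < μ istar)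
    (hexact : ∀ i, A.σ i = 0 → ∀ t k, x t k i = μ i) {ε : ℝ}
    (hε : ∀ i, i ≠ istar → 2 * ε ≤ μ istar - μ i) (hε0 : 0 < ε) {c : Fin N → ℝ}
    (hc1 : ∀ i, c i ≤ 1) (hcσ : ∀ i, 0 < A.σ i → c i * (A.σ istar : ℝ) ^ 2 ≤ (A.σ i : ℝ) ^ 2)
    {t T : ℕ} (ht : 2 ≤ t) (htT : t ≤ T) {k : Fin K} (h : A.Shares (x 0) t (A.stats x t) k) :
    (∃ i, A.bonus t (A.stats x t) k i < |estMean (x 0) (A.stats x t) k i - μ i|) ∨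
    (∃ i, A.play (x 0) t (A.stats x t) k = i ∧ ((A.stats x t).obs k i : ℝ) + 1 ≤
      8 * (A.σ i : ℝ) ^ 2 * (A.ξ + 1) / (μ istar - μ i) ^ 2 * Real.log T) ∨
    (∃ i, A.play (x 0) t (A.stats x t) k = istar ∧
      c i * (((A.stats x t).obs k istar : ℝ) + 1) ≤ ((A.stats x t).obs k i : ℝ) + 1 ∧
      ε ≤ |estMean (x 0) (A.stats x t) k i - μ i|) := by
  set s := A.stats x t with hs
  have hlog : 0 < Real.log t := Real.log_pos (by exact_mod_cast ht)
  have hξ := A.one_lt_ξ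
  set p := A.play (x 0) t s k with hp
  have hQ : ∀ j, A.objective (x 0) t s k j ≤ A.objective (x 0) t s k p := by
    have : p = A.argmaxQ t k (A.objective (x 0) t s k) := by
      rw [hp, play, if_neg (by omega)]
    rw [this]; exact A.le_argmaxQ t k _
  by_contra hcon
  push Not at hcon
  obtain ⟨hconf, hrare, hwrong⟩ := hcon
  simp only [objective] at hQ
  by_cases hpi : p = istar
  · set q := A.argmaxMean t k p (estMean (x 0) s k) with hq
    have hqne : q ≠ istar := fun hqi => h (hpi.trans hqi.symm)
    have hmean : estMean (x 0) s k istar ≤ estMean (x 0) s k q := A.le_argmaxMean t k p _ _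
    have hQq := hQ q
    rw [hpi] at hQq
    -- The optimal arm wins on the index without winning on the mean, so it wins on the bonus.
    have hbon : A.bonus t s k q ≤ A.bonus t s k istar := by linarith
    have hsq : A.bonus t s k q ^ 2 ≤ A.bonus t s k istar ^ 2 :=
      pow_le_pow_left₀ (A.bonus_nonneg _ _ _ _) hbon 2
    have e1 := A.bonus_sq_mul t s k q
    have e2 := A.bonus_sq_mul t s k istar
    have hgap := hε q hqne
    have hobs : ∀ i, (0 : ℝ) < (s.obs k i : ℝ) + 1 := fun i => by positivity
    -- As `c istar ≤ 1`, the third alternative also covers the optimal arm; its estimate is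
    -- therefore good, and the error of at least `ε` falls on `q`.
    have hst := hwrong istar hpi (mul_le_of_le_one_left (hobs istar).le (hc1 istar))
    have hqdev : ε ≤ |estMean (x 0) s k q - μ q| := by
      rw [abs_lt] at hst
      refine le_trans ?_ (le_abs_self _)
      linarith [hst.1]
    refine absurd hqdev (not_le.2 (hwrong q hpi ?_))
    -- An arm with zero proxy is estimated without error, so it cannot be `q`.
    have hσq : 0 < A.σ q := by
      refine pos_iff_ne_zero.2 fun h0 => ?_
      rw [A.estMean_sub, A.deviation_eq_zero x (hexact q h0), zero_div, abs_zero] at hqdev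
      linarith
    have hσq' : (0 : ℝ) < A.σ q := hσq
    have hcross : (A.σ q : ℝ) ^ 2 * ((s.obs k istar : ℝ) + 1) ≤
        (A.σ istar : ℝ) ^ 2 * ((s.obs k q : ℝ) + 1) := by
      have hpos : 0 < 2 * (A.ξ + 1) * Real.log t := by positivity
      refine le_of_mul_le_mul_right ?_ hpos
      calc (A.σ q : ℝ) ^ 2 * ((s.obs k istar : ℝ) + 1) * (2 * (A.ξ + 1) * Real.log t)
          = A.bonus t s k q ^ 2 * (((s.obs k q : ℝ) + 1) * ((s.obs k istar : ℝ) + 1)) := by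
            linear_combination -((s.obs k istar : ℝ) + 1) * e1
        _ ≤ A.bonus t s k istar ^ 2 * (((s.obs k q : ℝ) + 1) * ((s.obs k istar : ℝ) + 1)) :=
            mul_le_mul_of_nonneg_right hsq (mul_pos (hobs q) (hobs istar)).le
        _ = (A.σ istar : ℝ) ^ 2 * ((s.obs k q : ℝ) + 1) * (2 * (A.ξ + 1) * Real.log t) := by
            linear_combination ((s.obs k q : ℝ) + 1) * e2
    -- The left side of `hcross` is positive, which forces the right side to be so.
    have hσs : 0 < (A.σ istar : ℝ) ^ 2 := by
      have : 0 < (A.σ istar : ℝ) ^ 2 * ((s.obs k q : ℝ) + 1) :=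
        lt_of_lt_of_le (mul_pos (pow_pos hσq' 2) (hobs istar)) hcross
      exact (pos_iff_pos_of_mul_pos this).2 (hobs q)
    refine le_of_mul_le_mul_left ?_ hσs
    calc (A.σ istar : ℝ) ^ 2 * (c q * ((s.obs k istar : ℝ) + 1))
        = c q * (A.σ istar : ℝ) ^ 2 * ((s.obs k istar : ℝ) + 1) := by ring
      _ ≤ (A.σ q : ℝ) ^ 2 * ((s.obs k istar : ℝ) + 1) :=
          mul_le_mul_of_nonneg_right (hcσ q hσq) (hobs istar).le
      _ ≤ _ := hcross
  · have hgap := hopt p hpi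
    have h1 := (abs_le.1 (hconf p)).2
    have h2 := (abs_le.1 (hconf istar)).1
    have h3 := hQ istar
    have h4 : μ istar - μ p ≤ 2 * A.bonus t s k p := by linarith
    refine absurd (hrare p rfl) (not_lt.2 ?_)
    have h5 : (μ istar - μ p) ^ 2 ≤ 4 * A.bonus t s k p ^ 2 := by
      have := pow_le_pow_left₀ (by linarith) h4 2
      linarith
    have e1 := A.bonus_sq_mul t s k p
    have hd : 0 < (μ istar - μ p) ^ 2 := pow_pos (by linarith) 2
    have hlogT : Real.log t ≤ Real.log T :=
      Real.log_le_log (by positivity) (by exact_mod_cast htT)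
    rw [div_mul_eq_mul_div, le_div_iff₀ hd]
    calc ((s.obs k p : ℝ) + 1) * (μ istar - μ p) ^ 2
        ≤ ((s.obs k p : ℝ) + 1) * (4 * A.bonus t s k p ^ 2) :=
          mul_le_mul_of_nonneg_left h5 (by positivity)
      _ = 8 * (A.σ p : ℝ) ^ 2 * (A.ξ + 1) * Real.log t := by linear_combination 4 * e1
      _ ≤ _ := mul_le_mul_of_nonneg_left hlogT (by positivity)

open Classical in
-- The summand `2` pays for `t = 0` and `t = 1`, where `log t` vanishes. At `i = istar` the
-- logarithmic term is a division by zero, hence `0`.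
lemma commCost_le_sum {μ : Fin N → ℝ} {istar : Fin N} (hopt : ∀ i, i ≠ istar → μ i < μ istar)
    (hexact : ∀ i, A.σ i = 0 → ∀ t k, x t k i = μ i) {ε : ℝ}
    (hε : ∀ i, i ≠ istar → 2 * ε ≤ μ istar - μ i) (hε0 : 0 < ε) {c : Fin N → ℝ}
    (hc0 : ∀ i, 0 < c i) (hc1 : ∀ i, c i ≤ 1)
    (hcσ : ∀ i, 0 < A.σ i → c i * (A.σ istar : ℝ) ^ 2 ≤ (A.σ i : ℝ) ^ 2) (T : ℕ) :
    (A.commCost x T : ℝ) ≤ ∑ k, (2 + ∑ i,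
      ((∑ t ∈ Finset.Ico 2 T,
          if A.bonus t (A.stats x t) k i < |estMean (x 0) (A.stats x t) k i - μ i| then 1 else 0) +
        8 * (A.σ i : ℝ) ^ 2 * (A.ξ + 1) / (μ istar - μ i) ^ 2 * Real.log T +
        ∑ m ∈ Finset.range (K * T + 1),
          if A.MeanOff x (μ i) k i ε m T then ((m : ℝ) + 1) / c i else 0)) := by
  rw [commCost, Nat.cast_sum]
  refine Finset.sum_le_sum fun k _ => ?_
  rw [← Finset.card_filter]
  set E : Fin N → ℕ → Prop := fun i t =>
    A.bonus t (A.stats x t) k i < |estMean (x 0) (A.stats x t) k i - μ i|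
  set R : Fin N → ℕ → Prop := fun i t => A.play (x 0) t (A.stats x t) k = i ∧
    ((A.stats x t).obs k i : ℝ) + 1 ≤
      8 * (A.σ i : ℝ) ^ 2 * (A.ξ + 1) / (μ istar - μ i) ^ 2 * Real.log T
  set W : Fin N → ℕ → Prop := fun i t => A.play (x 0) t (A.stats x t) k = istar ∧
    c i * (((A.stats x t).obs k istar : ℝ) + 1) ≤ ((A.stats x t).obs k i : ℝ) + 1 ∧
    ε ≤ |estMean (x 0) (A.stats x t) k i - μ i|
  have hsub : ((Finset.range T).filter fun t => A.Shares (x 0) t (A.stats x t) k) ⊆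
      Finset.range 2 ∪ Finset.univ.biUnion fun i => ((Finset.Ico 2 T).filter (E i) ∪
        (Finset.range T).filter (R i)) ∪ (Finset.range T).filter (W i) := by
    intro t ht
    obtain ⟨htT, hsh⟩ := Finset.mem_filter.1 ht
    have htT' := Finset.mem_range.1 htT
    simp only [Finset.mem_union, Finset.mem_biUnion, Finset.mem_filter, Finset.mem_univ, true_and,
      Finset.mem_range, Finset.mem_Ico]
    rcases lt_or_ge t 2 with h2 | h2
    · exact Or.inl h2
    · rcases A.cases_of_shares x hopt hexact hε hε0 hc1 hcσ h2 htT'.le hsh with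
        ⟨i, hi⟩ | ⟨i, hi⟩ | ⟨i, hi⟩
      · exact Or.inr ⟨i, Or.inl (Or.inl ⟨⟨h2, htT'⟩, hi⟩)⟩
      · exact Or.inr ⟨i, Or.inl (Or.inr ⟨htT', hi⟩)⟩
      · exact Or.inr ⟨i, Or.inr ⟨htT', hi⟩⟩
  have hcard := (Finset.card_le_card hsub).trans ((Finset.card_union_le _ _).trans
    (add_le_add_right Finset.card_biUnion_le _))
  rw [Finset.card_range] at hcard
  refine (Nat.cast_le.2 hcard).trans ?_
  push_cast
  refine add_le_add le_rfl (Finset.sum_le_sum fun i _ => ?_)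
  refine (Nat.cast_le.2 ((Finset.card_union_le _ _).trans
    (add_le_add_left (Finset.card_union_le _ _) _))).trans ?_
  push_cast
  refine add_le_add (add_le_add (le_of_eq ?_) ?_) ?_
  · simp [E]
  · have hξ := A.one_lt_ξ
    have : 0 ≤ Real.log (T : ℝ) := Real.log_natCast_nonneg T
    exact A.card_play_obs_le x k i T (by positivity)
  · exact A.card_play_meanOff_le x (μ i) k i istar T (hc0 i)

end Pathwise

/-! ### Expected number of broadcasts -/

section Expectation

variable {K N : ℕ} (A : Protocol K N) {Ω : Type*} [MeasurableSpace Ω] {P : Measure Ω}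
  {ν : Fin N → Measure ℝ} {X : ℕ → Fin K → Fin N → Ω → ℝ}

lemma measurable_estMean_stats (hmeas : ∀ t k i, Measurable (X t k i)) (t : ℕ) (k : Fin K)
    (i : Fin N) : Measurable fun ω =>
      estMean (fun k i => X 0 k i ω) (A.stats (fun t k i => X t k i ω) t) k i := by
  obtain ⟨ho, ht⟩ := A.measurable_stats X t fun s _ => hmeas s
  exact (measurable_pi_apply i).comp (measurable_estMean (hmeas 0 k) (ho k) (ht k))

lemma measurableSet_bonus_lt (hmeas : ∀ t k i, Measurable (X t k i)) (μ : ℝ) (t : ℕ) (k : Fin K)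
    (i : Fin N) : MeasurableSet {ω | A.bonus t (A.stats (fun t k i => X t k i ω) t) k i <
      |estMean (fun k i => X 0 k i ω) (A.stats (fun t k i => X t k i ω) t) k i - μ|} := by
  obtain ⟨ho, -⟩ := A.measurable_stats X t fun s _ => hmeas s
  have h3 : Measurable fun ω => ((A.stats (fun t k i => X t k i ω) t).obs k i : ℝ) :=
    measurable_from_top.comp (ho k i)
  have hb : Measurable fun ω => A.bonus t (A.stats (fun t k i => X t k i ω) t) k i := by
    unfold bonus
    fun_prop
  exact measurableSet_lt hb ((A.measurable_estMean_stats hmeas t k i).sub_const μ).abs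

lemma measurableSet_meanOff (hmeas : ∀ t k i, Measurable (X t k i)) (μ : ℝ) (k : Fin K)
    (i : Fin N) (ε : ℝ) (m T : ℕ) :
    MeasurableSet {ω | A.MeanOff (fun t k i => X t k i ω) μ k i ε m T} := by
  have : {ω | A.MeanOff (fun t k i => X t k i ω) μ k i ε m T} = ⋃ t ∈ Set.Iic T,
      {ω | (A.stats (fun t k i => X t k i ω) t).obs k i = m} ∩
      {ω | ε ≤ |estMean (fun k i => X 0 k i ω) (A.stats (fun t k i => X t k i ω) t) k i - μ|} := by
    ext ω; simp [MeanOff, and_left_comm]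
  rw [this]
  refine MeasurableSet.biUnion (Set.to_countable _) fun t _ => ?_
  exact ((A.measurable_stats X t fun s _ => hmeas s).1 k i (measurableSet_singleton m)).inter
    (measurableSet_le measurable_const ((A.measurable_estMean_stats hmeas t k i).sub_const μ).abs)

lemma ae_eq_mean (hmeas : ∀ t k i, Measurable (X t k i)) (hlaw : ∀ t k i, P.map (X t k i) = ν i)
    {μ : Fin N → ℝ} (hsub : ∀ i, HasSubgaussianMGF (fun y => y - μ i) (A.σ i ^ 2) (ν i)) :
    ∀ᵐ ω ∂P, ∀ i, A.σ i = 0 → ∀ t k, X t k i ω = μ i := by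
  rw [ae_all_iff]; intro i
  by_cases h0 : A.σ i = 0
  · have h1 := hsub i
    rw [h0, zero_pow two_ne_zero] at h1
    have h2 : ∀ t k, ∀ᵐ ω ∂P, X t k i ω = μ i := fun t k => by
      have := h1.ae_eq_zero_of_hasSubgaussianMGF_zero
      rw [← hlaw t k i] at this
      filter_upwards [ae_of_ae_map (hmeas t k i).aemeasurable this] with ω hω
      exact sub_eq_zero.1 hω
    filter_upwards [ae_all_iff.2 fun t => ae_all_iff.2 (h2 t)] with ω hω _ using hω
  · exact ae_of_all _ fun ω h => absurd h h0

variable [IsProbabilityMeasure P] [∀ i, IsProbabilityMeasure (ν i)]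

/-- Each possible count fails with probability at most `2 * t ^ (-(ξ + 1))`; the union over `K * t +
1` counts costs a factor of order `t`, which explains the `ξ + 1` in the bonus. -/
lemma measureReal_bonus_lt_le (hmeas : ∀ t k i, Measurable (X t k i))
    (hlaw : ∀ t k i, P.map (X t k i) = ν i)
    (hindep : iIndepFun (fun (p : ℕ × Fin K) (ω : Ω) (i : Fin N) => X p.1 p.2 i ω) P)
    {μ : Fin N → ℝ} (hsub : ∀ i, HasSubgaussianMGF (fun y => y - μ i) (A.σ i ^ 2) (ν i))
    (k : Fin K) (i : Fin N) {t : ℕ} (ht : 1 ≤ t) :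
    P.real {ω | A.bonus t (A.stats (fun t k i => X t k i ω) t) k i <
      |estMean (fun k i => X 0 k i ω) (A.stats (fun t k i => X t k i ω) t) k i - μ i|} ≤
      2 * (K + 1) * (t : ℝ) ^ (-A.ξ) := by
  have ht0 : (0 : ℝ) < t := by exact_mod_cast ht
  -- The maximal inequality needs a positive proxy; with proxy `0` the error vanishes almost surely.
  rcases eq_or_ne (A.σ i) 0 with h0 | h0
  · refine le_of_eq_of_le ?_ (by positivity : (0 : ℝ) ≤ _)
    rw [measureReal_eq_zero_iff, ← compl_compl {ω | _}, ← mem_ae_iff]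
    filter_upwards [A.ae_eq_mean hmeas hlaw hsub] with ω hω
    have := A.estMean_sub (fun t k i => X t k i ω) (μ i) k i t
    rw [A.deviation_eq_zero _ (hω i h0), zero_div] at this
    simp only [Set.mem_compl_iff, Set.mem_ofPred_eq, not_lt, this, abs_zero]
    exact A.bonus_nonneg _ _ _ _
  have hσ : 0 < A.σ i := pos_iff_ne_zero.2 h0
  have hσ' : (0 : ℝ) < A.σ i := hσ
  have hξ := A.one_lt_ξ
  have hlog : 0 ≤ Real.log t := Real.log_natCast_nonneg t
  set y : ℕ → ℝ := fun m => A.σ i * √(2 * (A.ξ + 1) * Real.log t / (m + 1)) * (m + 1) with hy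
  have hyn : ∀ m, 0 ≤ y m := fun m => by positivity
  have hexp : ∀ m : ℕ, Real.exp (-(y m ^ 2 / (2 * (m + 1) * (A.σ i : ℝ) ^ 2))) =
      (t : ℝ) ^ (-(A.ξ + 1)) := fun m => by
    rw [Real.rpow_def_of_pos ht0]
    congr 1
    simp only [hy]
    rw [mul_pow, mul_pow, Real.sq_sqrt (by positivity)]
    field_simp
  have hsubset : {ω | A.bonus t (A.stats (fun t k i => X t k i ω) t) k i <
      |estMean (fun k i => X 0 k i ω) (A.stats (fun t k i => X t k i ω) t) k i - μ i|} ⊆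
      ⋃ m ∈ Finset.range (K * t + 1), {ω | ∃ s ≤ t,
        (A.stats (fun t k i => X t k i ω) s).obs k i = m ∧
        y m ≤ |A.deviation (fun t k i => X t k i ω) (μ i) k i s|} := by
    intro ω hω
    have hω' : A.bonus t (A.stats (fun t k i => X t k i ω) t) k i <
      |estMean (fun k i => X 0 k i ω) (A.stats (fun t k i => X t k i ω) t) k i - μ i| := hω
    simp only [Set.mem_iUnion, Finset.mem_range]
    refine ⟨_, Nat.lt_succ_of_le (A.obs_le (fun t k i => X t k i ω) t k i), t, le_rfl, rfl, ?_⟩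
    have hpos : (0 : ℝ) < (A.stats (fun t k i => X t k i ω) t).obs k i + 1 := by positivity
    rw [A.estMean_sub (fun t k i => X t k i ω), abs_div, abs_of_pos hpos, lt_div_iff₀ hpos] at hω'
    exact hω'.le
  calc _ ≤ _ := measureReal_mono hsubset (measure_ne_top _ _)
    _ ≤ ∑ m ∈ Finset.range (K * t + 1), P.real {ω | ∃ s ≤ t,
        (A.stats (fun t k i => X t k i ω) s).obs k i = m ∧
        y m ≤ |A.deviation (fun t k i => X t k i ω) (μ i) k i s|} :=
        measureReal_biUnion_finset_le _ _
    _ ≤ ∑ m ∈ Finset.range (K * t + 1), 2 * (t : ℝ) ^ (-(A.ξ + 1)) := by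
        refine Finset.sum_le_sum fun m _ => ?_
        rw [← hexp m]
        exact A.measure_deviation_le hmeas hlaw hindep hσ (hsub i) k m t (hyn m)
    _ = 2 * (K * t + 1) * (t : ℝ) ^ (-(A.ξ + 1)) := by
        simp only [Finset.sum_const, Finset.card_range, nsmul_eq_mul]
        push_cast; ring
    _ ≤ 2 * ((K + 1) * t) * (t : ℝ) ^ (-(A.ξ + 1)) := by
        have : (1 : ℝ) ≤ t := by exact_mod_cast ht
        gcongr
        linarith
    _ = 2 * (K + 1) * (t : ℝ) ^ (-A.ξ) := by
        have : (t : ℝ) ^ (-A.ξ) = t * (t : ℝ) ^ (-(A.ξ + 1)) := by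
          rw [show -A.ξ = 1 + -(A.ξ + 1) by ring, Real.rpow_add ht0, Real.rpow_one]
        rw [this]; ring

lemma measureReal_meanOff_le (hmeas : ∀ t k i, Measurable (X t k i))
    (hlaw : ∀ t k i, P.map (X t k i) = ν i)
    (hindep : iIndepFun (fun (p : ℕ × Fin K) (ω : Ω) (i : Fin N) => X p.1 p.2 i ω) P)
    {i : Fin N} {μ : ℝ} {σ : ℝ≥0} (hσ : 0 < σ)
    (hsub : HasSubgaussianMGF (fun y => y - μ) (σ ^ 2) (ν i)) (k : Fin K) {ε : ℝ} (hε : 0 ≤ ε)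
    (m T : ℕ) :
    P.real {ω | A.MeanOff (fun t k i => X t k i ω) μ k i ε m T} ≤
      2 * Real.exp (-(ε ^ 2 / (2 * σ ^ 2))) ^ (m + 1) := by
  have hσ' : (0 : ℝ) < σ := hσ
  have hm : (0 : ℝ) < (m : ℝ) + 1 := by positivity
  have h := A.measure_deviation_le hmeas hlaw hindep hσ hsub k m T (y := ε * (m + 1))
    (by positivity)
  have he : Real.exp (-(ε ^ 2 / (2 * (σ : ℝ) ^ 2))) ^ (m + 1) =
      Real.exp (-((ε * (m + 1)) ^ 2 / (2 * (m + 1) * (σ : ℝ) ^ 2))) := by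
    rw [← Real.exp_nat_mul]
    congr 1
    push_cast
    field_simp
  rw [he]
  refine le_trans (measureReal_mono ?_) h
  rintro ω ⟨t, ht, hn, hd⟩
  refine ⟨t, ht, hn, ?_⟩
  rw [A.estMean_sub (fun t k i => X t k i ω), hn, abs_div, abs_of_pos hm, le_div_iff₀ hm] at hd
  exact hd

lemma exists_sum_bonus_le (hmeas : ∀ t k i, Measurable (X t k i))
    (hlaw : ∀ t k i, P.map (X t k i) = ν i)
    (hindep : iIndepFun (fun (p : ℕ × Fin K) (ω : Ω) (i : Fin N) => X p.1 p.2 i ω) P)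
    {μ : Fin N → ℝ} (hsub : ∀ i, HasSubgaussianMGF (fun y => y - μ i) (A.σ i ^ 2) (ν i)) :
    ∃ C : ℝ, ∀ k i T, ∑ t ∈ Finset.Ico 2 T,
      P.real {ω | A.bonus t (A.stats (fun t k i => X t k i ω) t) k i <
      |estMean (fun k i => X 0 k i ω) (A.stats (fun t k i => X t k i ω) t) k i - μ i|} ≤ C := by
  have hs : Summable fun t : ℕ => 2 * ((K : ℝ) + 1) * (t : ℝ) ^ (-A.ξ) :=
    (Real.summable_nat_rpow.2 (neg_lt_neg A.one_lt_ξ)).mul_left _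
  refine ⟨∑' t : ℕ, 2 * ((K : ℝ) + 1) * (t : ℝ) ^ (-A.ξ), fun k i T => ?_⟩
  refine (Finset.sum_le_sum fun t ht => A.measureReal_bonus_lt_le hmeas hlaw hindep hsub k i
    (one_le_two.trans (Finset.mem_Ico.1 ht).1)).trans
    (hs.sum_le_tsum _ fun t _ => by positivity)

lemma exists_sum_meanOff_le (hmeas : ∀ t k i, Measurable (X t k i))
    (hlaw : ∀ t k i, P.map (X t k i) = ν i)
    (hindep : iIndepFun (fun (p : ℕ × Fin K) (ω : Ω) (i : Fin N) => X p.1 p.2 i ω) P)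
    {μ : Fin N → ℝ} (hsub : ∀ i, HasSubgaussianMGF (fun y => y - μ i) (A.σ i ^ 2) (ν i))
    {ε : ℝ} (hε : 0 < ε) (i : Fin N) :
    ∃ C : ℝ, ∀ k T, ∑ m ∈ Finset.range (K * T + 1), ((m : ℝ) + 1) *
      P.real {ω | A.MeanOff (fun t k i => X t k i ω) (μ i) k i ε m T} ≤ C := by
  -- A larger proxy is still valid, and is positive even when `σ i = 0`.
  set σ : ℝ≥0 := A.σ i + 1
  have hσ : 0 < σ := by positivity
  have hσ' : (0 : ℝ) < σ := hσ
  have hsub' : HasSubgaussianMGF (fun y => y - μ i) (σ ^ 2) (ν i) := by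
    refine ⟨(hsub i).integrable_exp_mul, fun l => ((hsub i).mgf_le l).trans ?_⟩
    have : A.σ i ^ 2 ≤ σ ^ 2 := pow_le_pow_left' le_self_add 2
    gcongr
  set r := Real.exp (-(ε ^ 2 / (2 * (σ : ℝ) ^ 2))) with hr
  have hr1 : r < 1 := Real.exp_lt_one_iff.2 (neg_lt_zero.2 (by positivity))
  have hr0 : 0 < r := Real.exp_pos _
  have hs : Summable fun m : ℕ => ((m : ℝ) + 1) * (2 * r ^ (m + 1)) := by
    have h := (summable_nat_add_iff 1).2 (summable_pow_mul_geometric_of_norm_lt_one 1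
      (r := r) (by rwa [Real.norm_of_nonneg hr0.le]))
    refine (h.mul_left 2).congr fun m => ?_
    push_cast; ring
  refine ⟨∑' m : ℕ, ((m : ℝ) + 1) * (2 * r ^ (m + 1)), fun k T => ?_⟩
  refine (Finset.sum_le_sum fun m _ => mul_le_mul_of_nonneg_left
    (A.measureReal_meanOff_le hmeas hlaw hindep hσ hsub' k hε.le m T) (by positivity)).trans
    (hs.sum_le_tsum _ fun m _ => by positivity)

lemma integrable_commCost (hmeas : ∀ t k i, Measurable (X t k i)) (T : ℕ) :
    Integrable (fun ω => (A.commCost (fun t k i => X t k i ω) T : ℝ)) P := by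
  refine Integrable.of_bound (C := (K * T : ℕ))
    (measurable_from_top.comp (A.measurable_commCost X hmeas T)).aestronglyMeasurable
    (ae_of_all _ fun ω => ?_)
  rw [Real.norm_of_nonneg (Nat.cast_nonneg _)]
  exact Nat.cast_le.2 (A.commCost_le _ T)

lemma exists_integral_commCost_le (hmeas : ∀ t k i, Measurable (X t k i))
    (hlaw : ∀ t k i, P.map (X t k i) = ν i)
    (hindep : iIndepFun (fun (p : ℕ × Fin K) (ω : Ω) (i : Fin N) => X p.1 p.2 i ω) P)
    {μ : Fin N → ℝ} (hsub : ∀ i, HasSubgaussianMGF (fun y => y - μ i) (A.σ i ^ 2) (ν i))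
    {istar : Fin N} (hopt : ∀ i, i ≠ istar → μ i < μ istar) :
    ∃ C D : ℝ, ∀ T : ℕ, ∫ ω, (A.commCost (fun t k i => X t k i ω) T : ℝ) ∂P ≤
      C + D * Real.log T := by
  classical
  obtain ⟨ε, hε0, hε⟩ : ∃ ε > 0, ∀ i, i ≠ istar → 2 * ε ≤ μ istar - μ i := by
    -- Half the smallest gap, with the dummy value `1` at `istar` so that a single arm is allowed.
    obtain ⟨j, -, hj⟩ := Finset.exists_min_image Finset.univ
      (fun i => if i = istar then 1 else (μ istar - μ i) / 2) ⟨istar, Finset.mem_univ _⟩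
    refine ⟨if j = istar then 1 else (μ istar - μ j) / 2, ?_, fun i hi => ?_⟩
    · split_ifs with h
      · exact one_pos
      · linarith [hopt j h]
    · have := hj i (Finset.mem_univ i)
      rw [if_neg hi] at this
      linarith
  have hcex : ∀ i, ∃ c : ℝ, 0 < c ∧ c ≤ 1 ∧
      (0 < A.σ i → c * (A.σ istar : ℝ) ^ 2 ≤ (A.σ i : ℝ) ^ 2) := fun i => by
    by_cases h : 0 < A.σ i
    · have h' : (0 : ℝ) < A.σ i := h
      refine ⟨min 1 ((A.σ i : ℝ) ^ 2 / ((A.σ istar : ℝ) ^ 2 + 1)),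
        -- The `+ 1` in the denominator guards against `σ istar = 0`.
        lt_min one_pos (by positivity), min_le_left _ _, fun _ => ?_⟩
      calc _ ≤ (A.σ i : ℝ) ^ 2 / ((A.σ istar : ℝ) ^ 2 + 1) * ((A.σ istar : ℝ) ^ 2 + 1) :=
            mul_le_mul (min_le_right _ _) (by linarith) (by positivity) (by positivity)
        _ = _ := div_mul_cancel₀ _ (by positivity)
    · exact ⟨1, one_pos, le_rfl, fun h' => absurd h' h⟩
  choose c hc0 hc1 hcσ using hcex
  obtain ⟨C₁, hC₁⟩ := A.exists_sum_bonus_le hmeas hlaw hindep hsub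
  choose C₂ hC₂ using A.exists_sum_meanOff_le hmeas hlaw hindep hsub hε0
  refine ⟨∑ _k : Fin K, (2 + ∑ i, (C₁ + C₂ i / c i)), ∑ _k : Fin K, ∑ i,
    8 * (A.σ i : ℝ) ^ 2 * (A.ξ + 1) / (μ istar - μ i) ^ 2, fun T => ?_⟩
  have hI : ∀ {p : Ω → Prop} (_ : MeasurableSet {ω | p ω}) (a : ℝ),
      Integrable (fun ω => if p ω then a else 0) P ∧
      ∫ ω, (if p ω then a else 0) ∂P = a * P.real {ω | p ω} := fun {p} hp a => by
    have he : (fun ω => if p ω then a else 0) = {ω | p ω}.indicator fun _ => a := by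
      ext ω; simp [Set.indicator_apply]
    rw [he, integral_indicator_const _ hp, smul_eq_mul, mul_comm]
    exact ⟨(integrable_const a).indicator hp, rfl⟩
  have hB := fun t k i => hI (A.measurableSet_bonus_lt hmeas (μ i) t k i) 1
  have hM := fun k i m => hI (A.measurableSet_meanOff hmeas (μ i) k i ε m T) ((m + 1) / c i)
  have hBi := fun k i => integrable_finsetSum (Finset.Ico 2 T) fun t _ => (hB t k i).1
  have hMi := fun k i => integrable_finsetSum (Finset.range (K * T + 1)) fun m _ => (hM k i m).1
  have hBl := fun k i => (hBi k i).add (integrable_const (μ := P)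
    (8 * (A.σ i : ℝ) ^ 2 * (A.ξ + 1) / (μ istar - μ i) ^ 2 * Real.log T))
  have hin := fun k => integrable_finsetSum Finset.univ fun i _ => (hBl k i).add (hMi k i)
  have hk := fun k => (integrable_const (μ := P) (2 : ℝ)).add (hin k)
  have hG := integrable_finsetSum Finset.univ fun k _ => hk k
  refine (integral_mono_of_nonneg (ae_of_all _ fun ω => Nat.cast_nonneg _) hG ?_).trans ?_
  · filter_upwards [A.ae_eq_mean hmeas hlaw hsub] with ω hω
    exact A.commCost_le_sum (fun t k i => X t k i ω) hopt hω hε hε0 hc0 hc1 hcσ T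
  · rw [integral_finsetSum _ fun k _ => hk k, Finset.sum_mul, ← Finset.sum_add_distrib]
    refine Finset.sum_le_sum fun k _ => ?_
    rw [integral_add' (integrable_const _) (hin k), integral_const, integral_finsetSum _
      fun i _ => (hBl k i).add (hMi k i), Finset.sum_mul, add_assoc, ← Finset.sum_add_distrib]
    refine add_le_add (by simp) (Finset.sum_le_sum fun i _ => ?_)
    rw [integral_add' (hBl k i) (hMi k i), integral_add' (hBi k i) (integrable_const _),
      integral_const, integral_finsetSum _ fun t _ => (hB t k i).1,
      integral_finsetSum _ fun m _ => (hM k i m).1]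
    simp only [fun t => (hB t k i).2, fun m => (hM k i m).2, one_mul, probReal_univ, one_smul]
    have h1 := hC₁ k i T
    have h2 := div_le_div_of_nonneg_right (hC₂ i k T) (hc0 i).le
    rw [Finset.sum_div] at h2
    simp only [div_mul_eq_mul_div] at h2 ⊢
    linarith

end Expectation

end Protocol

theorem lemma1 {K N : ℕ} (A : Protocol K N)
    {Ω : Type*} [MeasurableSpace Ω] (P : Measure Ω) [IsProbabilityMeasure P]
    -- the reward distributions of the arms, sub-Gaussian with variance proxies `σ i ^ 2`
    (ν : Fin N → Measure ℝ) [∀ i, IsProbabilityMeasure (ν i)]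
    (hsub : ∀ i, HasSubgaussianMGF (fun y => y - ∫ z, z ∂(ν i)) (A.σ i ^ 2) (ν i))
    -- the optimal arm
    (istar : Fin N) (hopt : ∀ i, i ≠ istar → ∫ z, z ∂(ν i) < ∫ z, z ∂(ν istar))
    -- the initial samples (`t = 0`) and the rewards (`t ≥ 1`), independent across times and agents
    (X : ℕ → Fin K → Fin N → Ω → ℝ)
    (hmeas : ∀ t k i, Measurable (X t k i))
    (hlaw : ∀ t k i, P.map (X t k i) = ν i)
    (hindep : iIndepFun (fun (p : ℕ × Fin K) (ω : Ω) (i : Fin N) => X p.1 p.2 i ω) P) :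
    (∀ T : ℕ, Integrable (fun ω => (A.commCost (fun t k i => X t k i ω) T : ℝ)) P) ∧
    (fun T : ℕ => ∫ ω, (A.commCost (fun t k i => X t k i ω) T : ℝ) ∂P)
      =O[atTop] (fun T : ℕ => Real.log (T : ℝ)) := by
  obtain ⟨C, D, hCD⟩ := A.exists_integral_commCost_le hmeas hlaw hindep hsub hopt
  refine ⟨A.integrable_commCost hmeas, IsBigO.of_bound (|C| + |D|) ?_⟩
  filter_upwards [eventually_ge_atTop 3] with T hT
  -- Since `e < 3 ≤ T`, the logarithm is at least `1` and absorbs the constant `C`.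
  have hlog : 1 ≤ Real.log (T : ℝ) := by
    rw [Real.le_log_iff_exp_le (by positivity)]
    exact Real.exp_one_lt_d9.le.trans (le_trans (by norm_num) (Nat.ofNat_le_cast.2 hT))
  rw [Real.norm_of_nonneg (integral_nonneg fun _ => Nat.cast_nonneg _),
    Real.norm_of_nonneg (zero_le_one.trans hlog), add_mul]
  refine (hCD T).trans (add_le_add ?_ ?_)
  · exact (le_abs_self C).trans (le_mul_of_one_le_right (abs_nonneg C) hlog)
  · exact mul_le_mul_of_nonneg_right (le_abs_self D) (zero_le_one.trans hlog)
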